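/- Let $\mathbb F$ be a finite field with $q$ elements and let $b\ge 0$. A *flag juggling state* is a word in the letters $-,1,\dots,b$, indexed by the positions $0,1,2,\dots$, in which each of the numbers $1,\dots,b$ occurs exactly once and all other letters are $-$; letters are compared with $-$ regarded as $+\infty$. Let $U_b$ be the set of $b\times\mathbb N$ matrices over $\mathbb F$ of rank $b$. For $M\in U_b$ the *flag invariant* $\tilde\sigma(M)$ is the unique state $\tilde\tau$ such that $M$ is obtained, by downward row operations (left multiplication by an invertible lower triangular matrix) and rightward column operations (right multiplication by an upper triangular $\mathbb N\times\mathbb N$ matrix with ones on the diagonal), from the partial permutation matrix whose entry $(i,j)$ is $1$ exactly when $\tilde\tau$ has the number $i$ in position $j$. *Digraph.* If $\tilde\tau$ begins with $-$, its only outgoing edge goes to $\tilde\tau$ with that $-$ removed. Otherwise remove the first letter of $\tilde\tau$, carry it, and walk right through the remaining word: at any $-$ one may replace the $-$ by the carried number and be done; at any number strictly larger than the carried one, one may pick up that number, drop the carried one in its place, and keep walking. There is an edge $\tilde\tau\to\tilde\tau''$ for each word $\tilde\tau''$ that can result after finitely many steps. *Backward bumping process from $\tilde\tau$.* Take a coin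 with probability $1/q$ of heads. (1) Hold a $-$ and point at the rightmost number of $\tilde\tau$. (2) Flip the coin; on tails put down what is held and pick up the number pointed at; on heads do nothing. (3) Move left, stopping at the first number smaller than what is held. (4) If there is such a number, go back to (2); otherwise attach what is held at the left end of the (modified) word and stop. (If there are no numbers, i.e. $b=0$, a $-$ is attached at the left end.) **Proposition.** Let $\tilde\tau$ be a flag juggling state, let $M\in U_b$ be the partial permutation matrix with $\tilde\sigma(M)=\tilde\tau$, and let $\vec c$ be uniformly distributed on $\mathbb F^b$. Then for every flag juggling state $\tau'$, the probability that $\tilde\sigma([\vec c\ M])=\tau'$ equals the probability that the backward bumping process started at $\tilde\tau$ ends at $\tau'$. In particular, the states $\tau'$ for which this probability is positive are exactly those with an edge $\tau'\to\tilde\tau$ in the digraph. -/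

import Mathlib

open scoped NNReal ENNReal

namespace FlagJuggling

/-- A flag juggling state with labels `1, …, b`: a word indexed by the positions `0, 1, 2, …`
in which every label is used exactly once, all other letters being a dash.  It is recorded by the
injective map sending a label to its position; the element `i : Fin b` is the label `i + 1`. -/
abbrev FlagState (b : ℕ) := Fin b ↪ ℕ

/-- The letter at position `j` of the word: a label, or `⊤` for a dash (so that a dash counts
as `+∞` when letters are compared). -/
def letter {b : ℕ} (s : FlagState b) (j : ℕ) : WithTop (Fin b) :=
  (Finset.univ.filter fun i => s i = j).min

theorem letter_eq_coe_iff {b : ℕ} (s : FlagState b) (j : ℕ) (i : Fin b) :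
    letter s j = i ↔ s i = j := by
  constructor
  · intro h
    simpa using Finset.mem_of_min h
  · intro h
    have : (Finset.univ.filter fun k => s k = j) = {i} := by
      ext k
      simp only [Finset.mem_filter, Finset.mem_univ, true_and, Finset.mem_singleton]
      rw [← h]
      exact s.injective.eq_iff
    rw [letter, this, Finset.min_singleton]

theorem letter_eq_top_iff {b : ℕ} (s : FlagState b) (j : ℕ) :
    letter s j = ⊤ ↔ ∀ i, s i ≠ j := by
  simp [letter, Finset.min_eq_top, Finset.filter_eq_empty_iff]

/-- The word obtained by exchanging the letters at positions `m` and `n`. -/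
def swapLetters {b : ℕ} (s : FlagState b) (m n : ℕ) : FlagState b :=
  s.trans (Equiv.swap m n).toEmbedding

/-- The word obtained by attaching a dash on the left. -/
def attachDash {b : ℕ} (s : FlagState b) : FlagState b :=
  s.trans ⟨Nat.succ, Nat.succ_injective⟩

/-! ### Matrices -/

/-- The `b × ℕ` matrices of full rank. -/
abbrev FullRankMatrix (F : Type*) [Field F] (b : ℕ) :=
  {M : Matrix (Fin b) ℕ F // LinearIndependent F M.row}

/-- The partial permutation matrix of a state: entry `(i, j)` is `1` if the label `i` is at
position `j`, and `0` otherwise. -/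
def permMatrix (F : Type*) [Field F] {b : ℕ} (s : FlagState b) : Matrix (Fin b) ℕ F :=
  Matrix.of fun i j => if s i = j then 1 else 0

/-- A partial permutation matrix: entries `0` and `1`, at most one `1` in each row and column. -/
def IsPartialPermutation {F : Type*} [Field F] {b : ℕ} (M : Matrix (Fin b) ℕ F) : Prop :=
  (∀ i j, M i j = 0 ∨ M i j = 1) ∧
    (∀ i j j', M i j = 1 → M i j' = 1 → j = j') ∧
    (∀ i i' j, M i j = 1 → M i' j = 1 → i = i')

/-- Rightward column operations: to each column `j` is added the linear combination
with coefficients `a k j` of the columns `k` to the left of it (this is right multiplication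
by an arbitrary upper triangular `ℕ × ℕ` matrix with ones on the diagonal). -/
def rightwardColumnOp {F : Type*} [Field F] {b : ℕ} (M : Matrix (Fin b) ℕ F) (a : ℕ → ℕ → F) :
    Matrix (Fin b) ℕ F :=
  Matrix.of fun i j => M i j + ∑ k ∈ Finset.range j, M i k * a k j

/-- An invertible lower triangular matrix; multiplying by it on the left performs downward row
operations (and rescalings of rows). -/
def IsDownwardRowOp {F : Type*} [Field F] {b : ℕ} (L : Matrix (Fin b) (Fin b) F) : Prop :=
  (∀ i k, i < k → L i k = 0) ∧ ∀ i, L i i ≠ 0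

/-- `M` is obtained from the partial permutation matrix of `s` by downward row operations and
rightward column operations. -/
def InOrbit {F : Type*} [Field F] {b : ℕ} (M : Matrix (Fin b) ℕ F) (s : FlagState b) : Prop :=
  ∃ (L : Matrix (Fin b) (Fin b) F) (a : ℕ → ℕ → F),
    IsDownwardRowOp L ∧ M = L * rightwardColumnOp (permMatrix F s) a

theorem colOp_permMatrix {F : Type*} [Field F] {b : ℕ} (s : FlagState b) (a : ℕ → ℕ → F)
    (i : Fin b) (j : ℕ) :
    rightwardColumnOp (permMatrix F s) a i j =
      if s i = j then 1 else if s i < j then a (s i) j else 0 := by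
  simp only [rightwardColumnOp, permMatrix, Matrix.of_apply, ite_mul, one_mul, zero_mul,
    Finset.sum_ite_eq, Finset.mem_range]
  split_ifs <;> first | omega | simp

theorem lower_zero {F : Type*} [Field F] {b : ℕ} {L : Matrix (Fin b) (Fin b) F}
    (hL : IsDownwardRowOp L) (v : Fin b → F) (h : ∀ i, ∑ k, L i k * v k = 0) (i : Fin b) :
    v i = 0 := by
  induction i using WellFoundedLT.induction with
  | ind i ih =>
    have h1 := h i
    rw [Finset.sum_eq_single i] at h1
    · exact (mul_eq_zero.mp h1).resolve_left (hL.2 i)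
    · intro k _ hk
      rcases lt_or_gt_of_ne hk with h2 | h2
      · rw [ih k h2, mul_zero]
      · rw [hL.1 i k h2, zero_mul]
    · simp

/-- Every matrix of full rank is in the orbit of some partial permutation matrix of rank `b`. -/
theorem exists_inOrbit {F : Type*} [Field F] : ∀ {b : ℕ} (M : Matrix (Fin b) ℕ F),
    LinearIndependent F M.row → ∃ s, InOrbit M s := by
  intro b
  induction b with
  | zero =>
    intro M _
    exact ⟨⟨fun i => i.elim0, fun i => i.elim0⟩, 1, 0, ⟨fun i => i.elim0, fun i => i.elim0⟩,
      by ext i; exact i.elim0⟩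
  | succ b ih =>
    classical
    intro M hM
    have h0 : ∃ p, M 0 p ≠ 0 := by
      by_contra! h
      exact hM.ne_zero 0 (funext h)
    let p := Nat.find h0
    have hp : M 0 p ≠ 0 := Nat.find_spec h0
    have hlt : ∀ j, j < p → M 0 j = 0 := fun j hj => by simpa using Nat.find_min h0 hj
    let M' : Matrix (Fin b) ℕ F := Matrix.of fun i j => M i.succ j - M i.succ p / M 0 p * M 0 j
    have hM' : LinearIndependent F M'.row := by
      rw [Fintype.linearIndependent_iff] at hM ⊢
      intro g hg i
      have := hM (Fin.cons (-∑ i, g i * (M i.succ p / M 0 p)) g) (by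
        ext j
        have := congrFun hg j
        simp only [Matrix.row, M', Finset.sum_apply, Pi.smul_apply, Matrix.of_apply, smul_eq_mul,
          Pi.zero_apply, mul_sub, Finset.sum_sub_distrib] at this
        simp only [Fin.sum_univ_succ, Fin.cons_zero, Fin.cons_succ, Matrix.row,
          Finset.sum_apply, Pi.smul_apply, smul_eq_mul, Pi.zero_apply, neg_mul, Finset.sum_mul]
        rw [← this]
        simp only [mul_assoc]
        ring) i.succ
      simpa using this
    obtain ⟨s, L, a, hL, hE⟩ := ih M' hM'
    have hE' : ∀ i j, M' i j = ∑ k, L i k *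
        (if s k = j then 1 else if s k < j then a (s k) j else 0) := by
      intro i j
      rw [hE, Matrix.mul_apply]
      simp only [colOp_permMatrix]
    have hsp : ∀ k, s k ≠ p := by
      intro k hk
      have := lower_zero hL
        (fun k => if s k = p then 1 else if s k < p then a (s k) p else 0)
        (fun i => by
          rw [← hE']
          simp [M', hp]) k
      simp [hk] at this
    refine ⟨⟨Fin.cons p s, ?_⟩, Matrix.of (Fin.cons (Fin.cons (M 0 p) 0)
      fun i => Fin.cons (M i.succ p) (L i)), Function.update a p fun j => M 0 j / M 0 p, ⟨?_, ?_⟩, ?_⟩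
    · rw [Fin.cons_injective_iff]
      exact ⟨by rintro ⟨k, hk⟩; exact hsp k hk, s.injective⟩
    · intro i k hik
      induction i using Fin.cases with
      | zero =>
        induction k using Fin.cases with
        | zero => simp at hik
        | succ k => simp
      | succ i =>
        induction k using Fin.cases with
        | zero => simp at hik
        | succ k => simpa using hL.1 i k (by simpa using hik)
    · intro i
      induction i using Fin.cases with
      | zero => simpa using hp
      | succ i => simpa using hL.2 i
    · have key : ∀ j, (if p = j then (1 : F) else if p < j then M 0 j / M 0 p else 0)
          = M 0 j / M 0 p := by
        intro j
        split_ifs with h1 h2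
        · rw [← h1, div_self hp]
        · rfl
        · rw [hlt j (by omega), zero_div]
      ext i j
      rw [Matrix.mul_apply]
      simp only [colOp_permMatrix, Fin.sum_univ_succ, Function.Embedding.coeFn_mk, Fin.cons_zero,
        Fin.cons_succ, Function.update_self, Function.update_of_ne (hsp _), key]
      induction i using Fin.cases with
      | zero => simp [mul_div_cancel₀ _ hp]
      | succ i =>
        simp only [Matrix.of_apply, Fin.cons_succ, Fin.cons_zero]
        rw [← hE']
        simp only [M', Matrix.of_apply]
        ring

/-- A matrix lies in the orbit of at most one partial permutation matrix of rank `b`. -/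
theorem inOrbit_unique {F : Type*} [Field F] {b : ℕ} {M : Matrix (Fin b) ℕ F}
    {s t : FlagState b} (hs : InOrbit M s) (ht : InOrbit M t) : s = t := by
  classical
  obtain ⟨L, a, hL, rfl⟩ := hs
  obtain ⟨K, c, hK, h⟩ := ht
  have bt : ∀ {L : Matrix (Fin b) (Fin b) F}, IsDownwardRowOp L →
      L.BlockTriangular OrderDual.toDual := fun hL i j hij => hL.1 i j (by simpa using hij)
  have hdet : IsUnit K.det := by
    rw [Matrix.det_of_isLowerTriangular K (bt hK)]
    exact (Finset.prod_ne_zero_iff.mpr fun i _ => hK.2 i).isUnit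
  let _ := K.invertibleOfIsUnitDet hdet
  have hN : (K⁻¹ * L).BlockTriangular OrderDual.toDual :=
    (Matrix.blockTriangular_inv_of_blockTriangular (bt hK)).mul (bt hL)
  have h' : rightwardColumnOp (permMatrix F t) c =
      K⁻¹ * L * rightwardColumnOp (permMatrix F s) a := by
    rw [Matrix.mul_assoc, h, Matrix.nonsing_inv_mul_cancel_left _ _ hdet]
  generalize K⁻¹ * L = N at hN h'
  have hE : ∀ i j, (if t i = j then (1 : F) else if t i < j then c (t i) j else 0) =
      ∑ k, N i k * (if s k = j then 1 else if s k < j then a (s k) j else 0) := by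
    intro i j
    rw [← colOp_permMatrix, h', Matrix.mul_apply]
    simp only [colOp_permMatrix]
  have main : ∀ i, ∃ k, k ≤ i ∧ s k = t i := by
    intro i
    have hne : (Finset.univ.filter fun k => N i k ≠ 0).Nonempty := by
      by_contra hcon
      rw [Finset.not_nonempty_iff_eq_empty, Finset.filter_eq_empty_iff] at hcon
      have := hE i (t i)
      rw [Finset.sum_eq_zero fun k _ => by rw [not_not.mp (hcon (Finset.mem_univ k)), zero_mul]]
        at this
      simp at this
    obtain ⟨k, hk, hmin⟩ := Finset.exists_min_image _ s hne
    simp only [Finset.mem_filter, Finset.mem_univ, true_and] at hk hmin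
    have hval : ∀ j, j ≤ s k →
        ∑ m, N i m * (if s m = j then 1 else if s m < j then a (s m) j else 0) =
          if j = s k then N i k else 0 := by
      intro j hj
      have hz : ∀ m, m ≠ k → N i m * (if s m = j then 1 else if s m < j then a (s m) j else 0) = 0 := by
        intro m hm
        by_cases h0 : N i m = 0
        · rw [h0, zero_mul]
        · have h1 := hmin m h0
          have h2 : s m ≠ s k := fun h => hm (s.injective h)
          rw [if_neg (by omega), if_neg (by omega), mul_zero]
      rw [Finset.sum_eq_single k (fun m _ hm => hz m hm) (by simp)]
      by_cases h3 : j = s k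
      · simp [h3]
      · rw [if_neg (by omega), if_neg (by omega), if_neg h3, mul_zero]
    refine ⟨k, ?_, ?_⟩
    · by_contra hlt
      exact hk (hN (by simpa using hlt))
    · rcases lt_trichotomy (s k) (t i) with h1 | h1 | h1
      · have := hE i (s k)
        rw [hval _ le_rfl, if_pos rfl, if_neg (by omega), if_neg (by omega)] at this
        exact absurd this.symm hk
      · exact h1
      · have := hE i (t i)
        rw [hval _ h1.le, if_neg h1.ne] at this
        simp at this
  ext i
  induction i using WellFoundedLT.induction with
  | ind i ih =>
    obtain ⟨k, hk, hkt⟩ := main i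
    rcases hk.lt_or_eq with h1 | h1
    · exact absurd (t.injective ((ih k h1).symm.trans hkt)) h1.ne
    · rw [← hkt, h1]

/-- The flag invariant of a matrix of full rank: the unique state whose partial permutation matrix
can be turned into `M` by downward row operations and rightward column operations. -/
noncomputable def flagInvariant {F : Type*} [Field F] {b : ℕ} (M : FullRankMatrix F b) :
    FlagState b :=
  (exists_inOrbit M.1 M.2).choose

theorem flagInvariant_eq_iff {F : Type*} [Field F] {b : ℕ} (M : FullRankMatrix F b)
    (s : FlagState b) : flagInvariant M = s ↔ InOrbit M.1 s :=
  ⟨fun h => h ▸ (exists_inOrbit M.1 M.2).choose_spec,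
    fun h => inOrbit_unique (exists_inOrbit M.1 M.2).choose_spec h⟩

/-- Each state is the flag invariant of exactly one partial permutation matrix of full rank. -/
theorem existsUnique_partialPermutation (F : Type*) [Field F] {b : ℕ} (s : FlagState b) :
    ∃! M : FullRankMatrix F b, IsPartialPermutation M.1 ∧ flagInvariant M = s := by
  have orb : ∀ t : FlagState b, InOrbit (permMatrix F t) t := fun t =>
    ⟨1, 0, ⟨fun i k h => Matrix.one_apply_ne h.ne, fun i => by simp⟩, by
      rw [Matrix.one_mul]
      ext i j
      simp [rightwardColumnOp]⟩
  refine ⟨⟨permMatrix F s, ?_⟩, ⟨⟨?_, ?_, ?_⟩, (flagInvariant_eq_iff _ _).2 (orb s)⟩, ?_⟩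
  · rw [Fintype.linearIndependent_iff]
    intro g hg i
    simpa [Matrix.row, permMatrix] using congrFun hg (s i)
  · intro i j
    by_cases h : s i = j <;> simp [permMatrix, h]
  · intro i j j' h h'
    simp only [permMatrix, Matrix.of_apply, ite_eq_left_iff, zero_ne_one, imp_false, not_not]
      at h h'
    exact h.symm.trans h'
  · intro i i' j h h'
    simp only [permMatrix, Matrix.of_apply, ite_eq_left_iff, zero_ne_one, imp_false, not_not]
      at h h'
    exact s.injective (h.trans h'.symm)
  · rintro ⟨M, hM⟩ ⟨⟨h01, hr, hc⟩, hs⟩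
    have h1 : ∀ i, ∃ j, M i j = 1 := by
      intro i
      by_contra! h
      exact hM.ne_zero i (funext fun j => (h01 i j).resolve_right (h j))
    choose t ht using h1
    let r : FlagState b := ⟨t, fun i i' h => hc i i' (t i) (ht i) (h ▸ ht i')⟩
    have hMt : M = permMatrix F r := by
      ext i j
      change M i j = if t i = j then 1 else 0
      split_ifs with h
      · rw [← h, ht i]
      · exact (h01 i j).resolve_right fun h' => h (hr i _ _ (ht i) h')
    rw [flagInvariant_eq_iff] at hs
    have hsr : s = r := inOrbit_unique hs (by change InOrbit M r; rw [hMt]; exact orb r)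
    exact Subtype.ext (hMt.trans (congrArg (permMatrix F) hsr.symm))

/-- The matrix `[c M]`. -/
def prependColumn {F : Type*} [Field F] {b : ℕ} (c : Fin b → F) (M : FullRankMatrix F b) :
    FullRankMatrix F b :=
  ⟨Matrix.of fun i j =>
      match j with
      | 0 => c i
      | k + 1 => M.1 i k,
    LinearIndependent.of_comp (LinearMap.funLeft F F Nat.succ) M.2⟩

/-- The distribution of the flag invariant of `[c M]`, for `c` uniformly distributed on `F ^ b`. -/
noncomputable def randomColumnLaw {F : Type*} [Field F] [Fintype F] {b : ℕ}
    (M : FullRankMatrix F b) : PMF (FlagState b) :=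
  (PMF.uniformOfFintype (Fin b → F)).map fun c => flagInvariant (prependColumn c M)

/-! ### The backward process -/

/-- A coin with probability `1 / q` of heads (`true` is heads). -/
noncomputable def coin (q : ℝ≥0) (hq : 1 ≤ q) : PMF Bool :=
  PMF.ofFintype (fun heads => cond heads ((q⁻¹ : ℝ≥0) : ℝ≥0∞) (1 - ((q⁻¹ : ℝ≥0) : ℝ≥0∞))) (by
    have h : ((q⁻¹ : ℝ≥0) : ℝ≥0∞) ≤ 1 := by
      exact_mod_cast inv_le_one_of_one_le₀ hq
    simp [add_tsub_cancel_of_le h])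

/-- The leftward walk of the backward process.  The word `s` consists of what is currently held
(the letter at position `0`) followed by the current word (its position `j` is the position
`j + 1` of `s`).  The positions `n, n - 1, …, 1` of `s` are still to be visited, in this order.
At a letter smaller than the held one a coin is flipped; on tails the two are exchanged.  When
all positions have been visited, the held letter is dropped at the left end, which gives `s`. -/
noncomputable def backwardWalk (q : ℝ≥0) (hq : 1 ≤ q) {b : ℕ} :
    ℕ → FlagState b → PMF (FlagState b)
  | 0, s => PMF.pure s
  | n + 1, s =>
    if letter s (n + 1) < letter s 0 then
      (coin q hq).bind fun heads =>
        if heads then backwardWalk q hq n s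
        else backwardWalk q hq n (swapLetters s 0 (n + 1))
    else backwardWalk q hq n s

/-- The number of positions of the word up to and including its rightmost label. -/
def width {b : ℕ} (s : FlagState b) : ℕ := Finset.univ.sup fun i => s i + 1

/-- The backward bumping process started at `s`: hold a dash, point at the rightmost number of `s`,
and walk leftwards. -/
noncomputable def backwardBumping (q : ℝ≥0) (hq : 1 ≤ q) {b : ℕ} (s : FlagState b) :
    PMF (FlagState b) :=
  backwardWalk q hq (width s) (attachDash s)

theorem one_le_card (F : Type*) [Field F] [Fintype F] : (1 : ℝ≥0) ≤ (Fintype.card F : ℝ≥0) := by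
  exact_mod_cast Fintype.card_pos

/-! ### The digraph -/

/-- The eastward walk.  In the word `s` the letter at position `0` is the number being carried, and
the positions `n, n + 1, …` are still to be visited; `ThrowWalk t n s` says that the walk can end
with the word `t`, where position `0` (the hand) then holds the dash that was replaced. -/
inductive ThrowWalk {b : ℕ} (t : FlagState b) : ℕ → FlagState b → Prop
  /-- Continue walking without doing anything at position `n`. -/
  | skip (n : ℕ) (s : FlagState b) : ThrowWalk t (n + 1) s → ThrowWalk t n s
  /-- Pick up a strictly larger number, dropping the carried number in its place. -/
  | bump (n : ℕ) (s : FlagState b) : letter s n ≠ ⊤ → letter s 0 < letter s n →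
      ThrowWalk t (n + 1) (swapLetters s 0 n) → ThrowWalk t n s
  /-- Replace a dash with the carried number and be done. -/
  | place (n : ℕ) (s : FlagState b) : letter s n = ⊤ → swapLetters s 0 n = t → ThrowWalk t n s

/-- The edges `s ⟶ t` of the flag juggling digraph.  If `s` begins with a dash, then `t` is `s`
with that dash removed; otherwise the first letter of `s` is picked up and carried eastwards,
and `t` is the resulting word, with position `0` removed. -/
def FlagEdge {b : ℕ} (s t : FlagState b) : Prop :=
  (letter s 0 = ⊤ ∧ s = attachDash t) ∨ (letter s 0 ≠ ⊤ ∧ ThrowWalk (attachDash t) 1 s)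

end FlagJuggling

namespace FlagJuggling

/-! ### Letters and exchanges -/

/-! Both random states are the same explicit function of a random set of labels. Let `S` be the set
of `k` with `c k ≠ 0`. Label `i` ends at `bumpedPos τ S i`: it stays at `τ i + 1` if `i ∉ S`, and
otherwise goes to the minimum of `τ i + 1` and the largest `τ j + 1` with `j ∈ S`, `j < i` (to `0`
if there is no such `j`).

On the matrix side (`flagInvariant_prependColumn`), the nonzero entry of column `0` in a row `i ∈ S`
is cleared with that row `j`; the first nonzero entry is then the earlier of the two ones. In the
row of the least label of `S`, nothing can clear it. The resulting leading positions determine the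
orbit.

On the process side (`markedWalk_apply`), let the coin at `k` show tails exactly when `k ∈ S`. The
held letter is always the least label of `S` passed so far, and the formula holds at each stage for
the labels of `S` already passed. Each label is met at most once and `c k = 0` has probability
`1/q`, so the zeros of a uniform `c` serve as the coins (`map_markedWalk_uniformOfFintype`).

For the support, both outcomes of a coin are possible, and an exchange is its own inverse: the walk
leftwards on tails is a throw read backwards. -/

theorem letter_swapLetters_left {b : ℕ} (s : FlagState b) (m n : ℕ) :
    letter (swapLetters s m n) m = letter s n := by
  simp only [letter, swapLetters, Function.Embedding.trans_apply, Equiv.coe_toEmbedding,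
    Equiv.swap_apply_eq_iff, Equiv.swap_apply_left]

theorem letter_swapLetters_right {b : ℕ} (s : FlagState b) (m n : ℕ) :
    letter (swapLetters s m n) n = letter s m := by
  simp only [letter, swapLetters, Function.Embedding.trans_apply, Equiv.coe_toEmbedding,
    Equiv.swap_apply_eq_iff, Equiv.swap_apply_right]

theorem swapLetters_swapLetters {b : ℕ} (s : FlagState b) (m n : ℕ) :
    swapLetters (swapLetters s m n) m n = s := by
  ext i
  simp [swapLetters]

theorem swapLetters_apply {b : ℕ} (s : FlagState b) (m n : ℕ) (i : Fin b) :
    swapLetters s m n i = Equiv.swap m n (s i) := rfl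

theorem attachDash_apply {b : ℕ} (s : FlagState b) (i : Fin b) : attachDash s i = s i + 1 := rfl

theorem letter_attachDash_zero {b : ℕ} (s : FlagState b) : letter (attachDash s) 0 = ⊤ := by
  simp [letter_eq_top_iff, attachDash_apply]

/-- Treats labels and dashes uniformly: at a dash the right side is vacuous. -/
theorem coe_lt_letter_iff {b : ℕ} (s : FlagState b) (j : ℕ) (k : Fin b) :
    (k : WithTop (Fin b)) < letter s j ↔ ∀ h, s h = j → k < h := by
  cases hl : letter s j with
  | top =>
    rw [letter_eq_top_iff] at hl
    simp [hl]
  | coe h =>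
    rw [letter_eq_coe_iff] at hl
    rw [WithTop.coe_lt_coe]
    exact ⟨fun hk h' hh' => s.injective (hl.trans hh'.symm) ▸ hk, fun H => H h hl⟩

theorem lt_width {b : ℕ} (s : FlagState b) (i : Fin b) : s i < width s :=
  Finset.le_sup (f := fun i => s i + 1) (Finset.mem_univ i)

/-! ### The backward walk with prescribed coins -/

open Classical in
/-- The leftward walk of the backward process in which the coin flipped at the label `k` shows
tails exactly when `k ∈ S`. -/
noncomputable def markedWalk {b : ℕ} (S : Finset (Fin b)) : ℕ → FlagState b → FlagState b
  | 0, s => s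
  | n + 1, s =>
    if ∃ k ∈ S, s k = n + 1 ∧ (k : WithTop (Fin b)) < letter s 0 then
      markedWalk S n (swapLetters s 0 (n + 1))
    else markedWalk S n s

/-- Coins of labels already passed or in the hand are never consulted again: an exchange only moves
labels between positions `0` and `n + 1`, outside the range still to be visited. -/
theorem markedWalk_congr {b : ℕ} {S S' : Finset (Fin b)} (n : ℕ) (s : FlagState b)
    (h : ∀ k, 1 ≤ s k → s k ≤ n → (k ∈ S ↔ k ∈ S')) : markedWalk S n s = markedWalk S' n s := by
  induction n generalizing s with
  | zero => rfl
  | succ n ih =>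
    have hc : (∃ k ∈ S, s k = n + 1 ∧ (k : WithTop (Fin b)) < letter s 0) ↔
        ∃ k ∈ S', s k = n + 1 ∧ (k : WithTop (Fin b)) < letter s 0 := by
      refine exists_congr fun k => ?_
      by_cases hk : s k = n + 1
      · rw [h k (by omega) (by omega)]
      · simp [hk]
    rw [markedWalk, markedWalk, if_congr hc (ih _ ?_) (ih _ ?_)]
    · intro k h1 h2
      rw [swapLetters_apply, Equiv.swap_apply_def] at h1 h2
      split_ifs at h1 h2 with h3 h4
      · omega
      · omega
      · exact h k h1 (by omega)
    · exact fun k h1 h2 => h k h1 (by omega)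

/-- The largest `s j + 1` for `j ∈ S` smaller than `i`, or `0` if there is no such `j`. -/
def reach {b : ℕ} (s : FlagState b) (S : Finset (Fin b)) (i : Fin b) : ℕ :=
  (S.filter (· < i)).sup fun j => s j + 1

/-- The position of the label `i` in the word obtained from `s` by the backward process in which
exactly the coins of the labels in `S` show tails. -/
def bumpedPos {b : ℕ} (s : FlagState b) (S : Finset (Fin b)) (i : Fin b) : ℕ :=
  if i ∈ S then min (s i + 1) (reach s S i) else s i + 1

theorem le_reach {b : ℕ} (s : FlagState b) {S : Finset (Fin b)} {i j : Fin b} (hj : j ∈ S)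
    (hji : j < i) : s j + 1 ≤ reach s S i :=
  Finset.le_sup (f := fun j => s j + 1) (Finset.mem_filter.2 ⟨hj, hji⟩)

theorem reach_eq_zero_or {b : ℕ} (s : FlagState b) (S : Finset (Fin b)) (i : Fin b) :
    (reach s S i = 0 ∧ ∀ j ∈ S, i ≤ j) ∨ ∃ j ∈ S, j < i ∧ reach s S i = s j + 1 := by
  rcases (S.filter (· < i)).eq_empty_or_nonempty with h | h
  · refine Or.inl ⟨by simp [reach, h], fun j hj => ?_⟩
    rw [Finset.filter_eq_empty_iff] at h
    exact not_lt.1 (h hj)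
  · obtain ⟨j, hj, hs⟩ := Finset.exists_mem_eq_sup _ h fun j => s j + 1
    rw [Finset.mem_filter] at hj
    exact Or.inr ⟨j, hj.1, hj.2, hs⟩

theorem reach_insert {b : ℕ} (s : FlagState b) (S : Finset (Fin b)) (k i : Fin b) :
    reach s (insert k S) i = if k < i then max (s k + 1) (reach s S i) else reach s S i := by
  rw [reach, Finset.filter_insert]
  split_ifs <;> simp [reach]

/-- Position `n + 1` of the word held the label `k` with `τ k = n`, so the filter keeps the labels
of `S` already passed when positions `n, …, 1` remain. The hypothesis is the loop invariant; at `n =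
0` the filter is all of `S`. -/
theorem markedWalk_apply {b : ℕ} (τ : FlagState b) (S : Finset (Fin b)) (n : ℕ) (s : FlagState b)
    (hs : ∀ i, s i = bumpedPos τ (S.filter fun k => n ≤ τ k) i) (i : Fin b) :
    markedWalk S n s i = bumpedPos τ S i := by
  induction n generalizing s with
  | zero => simpa [markedWalk] using hs i
  | succ n ih =>
    set S₁ := S.filter fun k => n + 1 ≤ τ k with hS₁
    have mem₁ : ∀ {k}, k ∈ S₁ → n + 1 ≤ τ k := fun hk => (Finset.mem_filter.1 hk).2
    -- Labels of `S₁` started strictly to the right of position `n + 1`, so none can have been put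
    -- down there: the letter now visited is still the original one.
    have hr : ∀ i, reach τ S₁ i = 0 ∨ n + 2 ≤ reach τ S₁ i := by
      intro i
      rcases reach_eq_zero_or τ S₁ i with h | ⟨j, hj, _, h⟩
      · exact Or.inl h.1
      · have := mem₁ hj
        omega
    have hτ : ∀ k, s k = n + 1 → τ k = n := by
      intro k hk
      rw [hs, bumpedPos] at hk
      split_ifs at hk with h
      · have := mem₁ h
        rcases hr k with h' | h' <;> omega
      · omega
    have hτ' : ∀ k, τ k = n → s k = n + 1 := by
      intro k hk
      rw [hs, bumpedPos, if_neg fun h => by have := mem₁ h; omega, hk]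
    rw [markedWalk]
    by_cases hk : ∃ k ∈ S, τ k = n
    · obtain ⟨k, hkS, hkn⟩ := hk
      have hk₁ : k ∉ S₁ := fun h => by have := mem₁ h; omega
      have hS₀ : (S.filter fun k => n ≤ τ k) = insert k S₁ := by
        ext j
        simp only [hS₁, Finset.mem_filter, Finset.mem_insert]
        constructor
        · rintro ⟨h1, h2⟩
          rcases h2.eq_or_lt with h | h
          · exact Or.inl (τ.injective (h.symm.trans hkn.symm))
          · exact Or.inr ⟨h1, h⟩
        · rintro (rfl | ⟨h1, h2⟩)
          · exact ⟨hkS, hkn.ge⟩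
          · exact ⟨h1, by omega⟩
      have hsk := hτ' k hkn
      by_cases hlt : (k : WithTop (Fin b)) < letter s 0
      · rw [if_pos ⟨k, hkS, hsk, hlt⟩]
        rw [coe_lt_letter_iff] at hlt
        -- The least label of `S₁` has reach `0`, so it is the held letter; being below the held
        -- letter means being below all of `S₁`.
        have hmin : ∀ j ∈ S₁, k < j := by
          intro j hj
          have hne : S₁.Nonempty := ⟨j, hj⟩
          refine (hlt (S₁.min' hne) ?_).trans_le (S₁.min'_le j hj)
          rw [hs, bumpedPos, if_pos (S₁.min'_mem hne)]
          rcases reach_eq_zero_or τ S₁ (S₁.min' hne) with h' | ⟨m, hm, hmj, _⟩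
          · simp [h'.1]
          · exact absurd (S₁.min'_le m hm) (not_le.2 hmj)
        have hrk : reach τ S₁ k = 0 := by
          rcases reach_eq_zero_or τ S₁ k with h' | ⟨j, hj, hjh, _⟩
          · exact h'.1
          · exact absurd (hmin j hj) hjh.asymm
        refine ih _ fun i => ?_
        rw [hS₀, bumpedPos, reach_insert, swapLetters_apply]
        by_cases hik : i = k
        · subst hik
          simp [hsk, hrk]
        by_cases hi : i ∈ S₁
        · have hki := hmin i hi
          have := mem₁ hi
          have hsi := hs i
          rw [bumpedPos, if_pos hi] at hsi
          rw [if_pos (Finset.mem_insert_of_mem hi), if_pos hki, hkn]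
          -- Reach `0` means that `i` was held and is put down at `n + 1`. Any other `i ∈ S₁` has
          -- reach at least `n + 2`, which the new candidate `τ k + 1 = n + 1` does not change.
          rcases hr i with h0 | h0
          · rw [h0, Nat.min_zero] at hsi
            rw [hsi, Equiv.swap_apply_left, h0]
            omega
          · rw [Equiv.swap_apply_of_ne_of_ne (by omega) (by omega), hsi]
            omega
        · rw [if_neg (by simp [hik, hi])]
          have hsi := hs i
          rw [bumpedPos, if_neg hi] at hsi
          rw [Equiv.swap_apply_of_ne_of_ne (by omega), hsi]
          exact fun h => hik (s.injective (h.trans hsk.symm))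
      · rw [if_neg]
        · rw [coe_lt_letter_iff] at hlt
          push Not at hlt
          obtain ⟨h, hs0, hhk⟩ := hlt
          have hhk : h < k := hhk.lt_of_ne fun e => by rw [e] at hs0; omega
          have hh₁ : h ∈ S₁ := by
            by_contra hcon
            rw [hs, bumpedPos, if_neg hcon] at hs0
            omega
          -- No coin is flipped at `k`, yet `k ∈ S`. The formula ignores `k`: the held `h < k`
          -- already gives every label from `k` on a reach beyond `n + 1`.
          have hlarge : ∀ i, k ≤ i → n + 2 ≤ reach τ S₁ i := fun i hi => by
            have := le_reach τ hh₁ (hhk.trans_le hi)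
            have := mem₁ hh₁
            omega
          refine ih _ fun i => ?_
          rw [hS₀, bumpedPos, reach_insert, hs, bumpedPos]
          by_cases hik : i = k
          · subst hik
            have := hlarge i le_rfl
            simp [hk₁]
            omega
          · simp only [Finset.mem_insert, hik, false_or]
            split_ifs with h1 h2
            · have := hlarge i h2.le
              omega
            · rfl
            · rfl
        · rintro ⟨j, _, hj, hj'⟩
          exact hlt (s.injective (hsk.trans hj.symm) ▸ hj')
    · rw [if_neg fun ⟨k, hk1, hk2, _⟩ => hk ⟨k, hk1, hτ k hk2⟩]
      refine ih _ fun i => ?_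
      rw [hs]
      congr 1
      refine Finset.filter_congr fun k hkS => ?_
      have : τ k ≠ n := fun h => hk ⟨k, hkS, h⟩
      omega

theorem markedWalk_attachDash_apply {b : ℕ} (τ : FlagState b) (S : Finset (Fin b)) (i : Fin b) :
    markedWalk S (width τ) (attachDash τ) i = bumpedPos τ S i := by
  refine markedWalk_apply τ S _ _ (fun i => ?_) i
  rw [bumpedPos, if_neg, attachDash_apply]
  simp [lt_width]

/-! ### The flag invariant of a matrix with a new first column -/

/-- If the rows of `N` have distinct leading positions `s i`, then `L * N` is in the orbit of `s`
for every downward row operation `L`. -/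
theorem inOrbit_of_leading {F : Type*} [Field F] {b : ℕ} {L : Matrix (Fin b) (Fin b) F}
    {N : Matrix (Fin b) ℕ F} {s : FlagState b} (hL : IsDownwardRowOp L)
    (h0 : ∀ i j, j < s i → N i j = 0) (h1 : ∀ i, N i (s i) ≠ 0) : InOrbit (L * N) s := by
  classical
  -- The diagonal factor makes the leading entries `1`. The normalized row `i` then serves as row `s
  -- i` of the column operation; injectivity of `s` makes this unambiguous, and the other rows are
  -- irrelevant.
  refine ⟨L * Matrix.diagonal fun i => N i (s i),
    Function.extend s (fun i j => N i j / N i (s i)) 0, ⟨fun i k hik => ?_, fun i => ?_⟩, ?_⟩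
  · rw [Matrix.mul_diagonal, hL.1 i k hik, zero_mul]
  · rw [Matrix.mul_diagonal]
    exact mul_ne_zero (hL.2 i) (h1 i)
  · rw [Matrix.mul_assoc]
    congr 1
    ext i j
    rw [Matrix.diagonal_mul, colOp_permMatrix, s.injective.extend_apply]
    split_ifs with h2 h3
    · rw [← h2, mul_one]
    · rw [mul_div_cancel₀ _ (h1 i)]
    · rw [h0 i j (by omega), mul_zero]

/-- Version of `inOrbit_of_leading` in which the row operation is applied to `M`. -/
theorem inOrbit_of_mul_leading {F : Type*} [Field F] {b : ℕ} {K : Matrix (Fin b) (Fin b) F}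
    {M : Matrix (Fin b) ℕ F} {s : FlagState b} (hK : IsDownwardRowOp K)
    (h0 : ∀ i j, j < s i → (K * M) i j = 0) (h1 : ∀ i, (K * M) i (s i) ≠ 0) : InOrbit M s := by
  have bt : K.BlockTriangular OrderDual.toDual := fun i j hij => hK.1 i j (by simpa using hij)
  have hdet : IsUnit K.det := by
    rw [Matrix.det_of_isLowerTriangular K bt]
    exact (Finset.prod_ne_zero_iff.mpr fun i _ => hK.2 i).isUnit
  let _ := K.invertibleOfIsUnitDet hdet
  have bt' : K⁻¹.BlockTriangular OrderDual.toDual :=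
    Matrix.blockTriangular_inv_of_blockTriangular bt
  have hL : IsDownwardRowOp K⁻¹ := by
    refine ⟨fun i k hik => bt' (by simpa using hik), ?_⟩
    have hdet' : IsUnit K⁻¹.det := (Matrix.isUnit_nonsing_inv_det K hdet)
    rw [Matrix.det_of_isLowerTriangular K⁻¹ bt'] at hdet'
    exact fun i => Finset.prod_ne_zero_iff.mp hdet'.ne_zero i (Finset.mem_univ i)
  have := inOrbit_of_leading hL h0 h1
  rwa [Matrix.nonsing_inv_mul_cancel_left _ _ hdet] at this

/-- A full rank partial permutation matrix is the partial permutation matrix of its flag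
invariant. -/
theorem eq_permMatrix {F : Type*} [Field F] {b : ℕ} {τ : FlagState b} {M : FullRankMatrix F b}
    (hM : IsPartialPermutation M.1) (hτ : flagInvariant M = τ) : M.1 = permMatrix F τ := by
  obtain ⟨M, hli⟩ := M
  obtain ⟨h01, hr, hc⟩ := hM
  have h1 : ∀ i, ∃ j, M i j = 1 := by
    intro i
    by_contra! h
    exact hli.ne_zero i (funext fun j => (h01 i j).resolve_right (h j))
  choose t ht using h1
  let r : FlagState b := ⟨t, fun i i' h => hc i i' (t i) (ht i) (h ▸ ht i')⟩
  have hMr : M = permMatrix F r := by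
    ext i j
    change M i j = if t i = j then 1 else 0
    split_ifs with h
    · rw [← h, ht i]
    · exact (h01 i j).resolve_right fun h' => h (hr i _ _ (ht i) h')
  have horb : InOrbit M r := by
    have := inOrbit_of_leading (L := 1) (N := permMatrix F r) (s := r)
      ⟨fun i k h => Matrix.one_apply_ne h.ne, fun i => by simp⟩
      (fun i j h => by simp [permMatrix, h.ne']) (fun i => by simp [permMatrix])
    rwa [Matrix.one_mul, ← hMr] at this
  rw [← hτ, (flagInvariant_eq_iff _ _).2 horb]
  exact hMr

/-- Distinctness of the leading positions is not checked by hand: it is contained in `t` being a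
state. -/
theorem flagInvariant_prependColumn {F : Type*} [Field F] [DecidableEq F] {b : ℕ}
    {τ t : FlagState b} {M : FullRankMatrix F b} (hM : M.1 = permMatrix F τ) (c : Fin b → F)
    (ht : ∀ i, t i = bumpedPos τ (Finset.univ.filter fun k => c k ≠ 0) i) :
    flagInvariant (prependColumn c M) = t := by
  set S := Finset.univ.filter fun k => c k ≠ 0 with hS
  have memS : ∀ k, k ∈ S ↔ c k ≠ 0 := fun k => by simp [hS]
  rw [flagInvariant_eq_iff]
  have hcol0 : ∀ i, (prependColumn c M).1 i 0 = c i := fun i => rfl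
  have hcol : ∀ i j, (prependColumn c M).1 i (j + 1) = if τ i = j then 1 else 0 := fun i j =>
    congrFun (congrFun hM i) j
  generalize (prependColumn c M).1 = A at hcol0 hcol
  -- `v` lists multiples of rows strictly above `i`, so `1 + Matrix.of v` is lower unitriangular.
  have hrow : ∀ i, ∃ v : Fin b → F, (∀ k, i ≤ k → v k = 0) ∧
      (∀ j < t i, A i j + ∑ k, v k * A k j = 0) ∧ A i (t i) + ∑ k, v k * A k (t i) ≠ 0 := by
    intro i
    rw [ht, bumpedPos]
    by_cases hi : i ∈ S
    · rw [if_pos hi]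
      rcases reach_eq_zero_or τ S i with h | ⟨m, hm, hmi, h⟩
      · refine ⟨0, fun _ _ => rfl, ?_, ?_⟩
        · simp [h.1]
        · simpa [h.1, hcol0] using (memS i).1 hi
      · have hcm := (memS m).1 hm
        have hne : τ i ≠ τ m := fun h => hmi.ne' (τ.injective h)
        have hsum : ∀ j, ∑ k, (Pi.single m (-(c i / c m)) : Fin b → F) k * A k j
            = -(c i / c m) * A m j := by
          intro j
          rw [Finset.sum_eq_single m (fun k _ hk => by simp [hk]) (by simp), Pi.single_eq_same]
        -- Row `m` attains the reach of `i`; this multiple of it cancels `c i` in column `0`.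
        refine ⟨Pi.single m (-(c i / c m)), fun k hk => ?_, fun j hj => ?_, ?_⟩
        · rw [Pi.single_eq_of_ne (hmi.trans_le hk).ne']
        · rw [hsum]
          cases j with
          | zero =>
            rw [hcol0, hcol0]
            field_simp
            ring
          | succ j =>
            rw [hcol, hcol, if_neg (by omega), if_neg (by omega)]
            simp
        · rw [hsum, h]
          -- The ones of rows `i` and `m` lie in different columns, so they cannot cancel and the
          -- earlier one leads.
          rcases hne.lt_or_gt with h' | h'
          · rw [min_eq_left (by omega), hcol, hcol, if_pos rfl, if_neg (by omega)]
            simp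
          · rw [min_eq_right (by omega), hcol, hcol, if_pos rfl, if_neg (by omega)]
            simpa [hcm] using (memS i).1 hi
    · rw [if_neg hi]
      refine ⟨0, fun _ _ => rfl, fun j hj => ?_, ?_⟩
      · cases j with
        | zero => simpa [hcol0] using fun h => hi ((memS i).2 h)
        | succ j => simpa [hcol] using fun h : τ i = j => by omega
      · simp [hcol]
  choose v hv0 hv1 hv2 using hrow
  have hmul : ∀ i j, ((1 + Matrix.of v) * A : Matrix (Fin b) ℕ F) i j = A i j + ∑ k, v i k * A k j := by
    intro i j
    rw [Matrix.add_mul, Matrix.one_mul, Matrix.add_apply, Matrix.mul_apply]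
    rfl
  refine inOrbit_of_mul_leading (K := 1 + Matrix.of v) ⟨fun i k hik => ?_, fun i => ?_⟩
    (fun i j hj => ?_) fun i => ?_
  · simp [Matrix.one_apply_ne hik.ne, hv0 i k hik.le]
  · simp [hv0 i i le_rfl]
  · rw [hmul, hv1 i j hj]
  · rw [hmul]
    exact hv2 i

/-! ### Random coins -/

theorem map_equiv_uniformOfFintype {α : Type*} [Fintype α] [Nonempty α] (e : α ≃ α) :
    (PMF.uniformOfFintype α).map e = PMF.uniformOfFintype α := by
  ext a
  rw [PMF.map_apply, tsum_eq_single (e.symm a)]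
  · simp
  · intro x hx
    rw [if_neg]
    rintro rfl
    simp at hx

/-- Resampling one coordinate does not change the uniform distribution. -/
theorem uniformOfFintype_resample {ι G : Type*} [Fintype ι] [DecidableEq ι] [AddGroup G]
    [Fintype G] (k : ι) :
    PMF.uniformOfFintype (ι → G) = (PMF.uniformOfFintype (ι → G)).bind fun c =>
      (PMF.uniformOfFintype G).map fun x => Function.update c k x := by
  -- Translating `x` by `c k` turns replacing the coordinate into adding to it. After exchanging the
  -- two draws, translation invariance of the uniform law of `c` finishes.
  have h1 : ∀ c : ι → G, ((PMF.uniformOfFintype G).map fun x => Function.update c k x) =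
      (PMF.uniformOfFintype G).bind fun x => PMF.pure (c + Pi.single k x) := by
    intro c
    conv_lhs => rw [← map_equiv_uniformOfFintype (Equiv.addLeft (c k)), PMF.map_comp]
    rw [← PMF.bind_pure_comp]
    congr 1
    funext x
    simp only [Function.comp_apply, Equiv.coe_addLeft]
    congr 1
    ext i
    by_cases hi : i = k
    · subst hi; simp
    · simp [hi]
  simp only [h1]
  rw [PMF.bind_comm]
  have h2 : ∀ x : G, ((PMF.uniformOfFintype (ι → G)).bind fun c =>
      PMF.pure (c + Pi.single k x)) = PMF.uniformOfFintype (ι → G) := fun x =>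
    (PMF.bind_pure_comp _ _).trans (map_equiv_uniformOfFintype (Equiv.addRight (Pi.single k x : ι → G)))
  simp only [h2, PMF.bind_const]

theorem map_eq_zero_uniformOfFintype {F : Type*} [Field F] [Fintype F] [DecidableEq F] :
    (PMF.uniformOfFintype F).map (fun x => decide (x = 0)) =
      coin (Fintype.card F) (one_le_card F) := by
  have htrue : (PMF.uniformOfFintype F).map (fun x => decide (x = 0)) true =
      coin (Fintype.card F) (one_le_card F) true := by
    rw [PMF.map_apply, tsum_eq_single 0]
    · have : (Fintype.card F : ℝ≥0) ≠ 0 := by simp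
      simp [coin, ENNReal.coe_inv this]
    · intro x hx
      simp [hx]
  have hsum : ∀ p : PMF Bool, p false = 1 - p true := by
    intro p
    have h := p.tsum_coe
    rw [tsum_fintype, Fintype.sum_bool] at h
    rw [← h, ENNReal.add_sub_cancel_left (p.apply_ne_top _)]
  ext a
  cases a
  · rw [hsum, hsum, htrue]
  · exact htrue

/-- Flipping the coins according to the zeros of a uniformly distributed vector gives the
leftward walk of the backward process. -/
theorem map_markedWalk_uniformOfFintype {F : Type*} [Field F] [Fintype F] [DecidableEq F] {b : ℕ}
    (n : ℕ) (s : FlagState b) :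
    (PMF.uniformOfFintype (Fin b → F)).map
        (fun c => markedWalk (Finset.univ.filter fun k => c k ≠ 0) n s) =
      backwardWalk (Fintype.card F) (one_le_card F) n s := by
  induction n generalizing s with
  | zero =>
    simp only [markedWalk, backwardWalk]
    exact PMF.map_const _ _
  | succ n ih =>
    rw [backwardWalk]
    split_ifs with hlt
    · obtain ⟨k, hk⟩ := WithTop.ne_top_iff_exists.1 hlt.ne_top
      rw [← hk] at hlt
      have hk := (letter_eq_coe_iff s (n + 1) k).1 hk.symm
      -- Coordinate `k` decides the present coin only: afterwards `k` is at position `0` or `n + 1`,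
      -- so the rest of the walk may use the old `c`.
      have hstep : ∀ (c : Fin b → F) (x : F),
          markedWalk (Finset.univ.filter fun j => Function.update c k x j ≠ 0) (n + 1) s =
            markedWalk (Finset.univ.filter fun j => c j ≠ 0) n
              (if decide (x = 0) then s else swapLetters s 0 (n + 1)) := by
        intro c x
        have hc : (∃ j ∈ Finset.univ.filter fun j => Function.update c k x j ≠ 0,
            s j = n + 1 ∧ (j : WithTop (Fin b)) < letter s 0) ↔ x ≠ 0 := by
          constructor
          · rintro ⟨j, hj, hj', _⟩
            obtain rfl : j = k := s.injective (hj'.trans hk.symm)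
            simpa using hj
          · exact fun hx => ⟨k, by simpa using hx, hk, hlt⟩
        rw [markedWalk, if_congr hc rfl rfl]
        by_cases hx : x = 0
        · rw [if_neg (by simpa using hx), if_pos (by simpa using hx)]
          refine markedWalk_congr _ _ fun j _ hj => ?_
          have : j ≠ k := fun h => by rw [h] at hj; omega
          simp [this]
        · rw [if_pos hx, if_neg (by simpa using hx)]
          refine markedWalk_congr _ _ fun j hj _ => ?_
          have : j ≠ k := fun h => by
            rw [h, swapLetters_apply, hk, Equiv.swap_apply_right] at hj
            omega
          simp [this]
      -- Drawing coordinate `k` afresh makes this coin independent of the vector governing the rest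
      -- of the walk.
      rw [uniformOfFintype_resample k, PMF.map_bind]
      simp only [PMF.map_comp, Function.comp_def, hstep]
      simp only [← PMF.bind_pure_comp, Function.comp_def]
      rw [PMF.bind_comm, ← map_eq_zero_uniformOfFintype, PMF.bind_map]
      congr 1
      funext x
      rw [Function.comp_apply]
      have := ih (if decide (x = 0) then s else swapLetters s 0 (n + 1))
      rw [← PMF.bind_pure_comp] at this
      refine this.trans ?_
      split_ifs <;> rfl
    · rw [← ih]
      congr 1
      funext c
      rw [markedWalk, if_neg]
      rintro ⟨k, _, hk, hk'⟩
      rw [← letter_eq_coe_iff] at hk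
      exact hlt (hk ▸ hk')

/-! ### The support of the backward process -/

/-- At `q = 1` tails would be impossible, hence the strict inequality. -/
theorem support_coin {q : ℝ≥0} (hq : 1 < q) : (coin q hq.le).support = Set.univ := by
  ext a
  have hq' : ((q⁻¹ : ℝ≥0) : ℝ≥0∞) < 1 := by
    exact_mod_cast inv_lt_one_of_one_lt₀ hq
  cases a
  · simpa only [coin, PMF.mem_support_iff, PMF.ofFintype_apply, cond_false, Set.mem_univ, iff_true]
      using (tsub_pos_of_lt hq').ne'
  · simp [coin, (zero_lt_one.trans hq).ne']

theorem mem_support_backwardWalk_succ {q : ℝ≥0} (hq : 1 < q) {b : ℕ} (n : ℕ) (s t : FlagState b) :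
    t ∈ (backwardWalk q hq.le (n + 1) s).support ↔
      t ∈ (backwardWalk q hq.le n s).support ∨ (letter s (n + 1) < letter s 0 ∧
        t ∈ (backwardWalk q hq.le n (swapLetters s 0 (n + 1))).support) := by
  rw [backwardWalk]
  split_ifs with h
  · rw [PMF.mem_support_bind_iff, support_coin hq]
    simp [h, or_comm]
  · simp [h]

theorem mem_support_backwardWalk_mono {q : ℝ≥0} (hq : 1 < q) {b : ℕ} {m n : ℕ} (hmn : m ≤ n)
    {s t : FlagState b} (h : t ∈ (backwardWalk q hq.le m s).support) :
    t ∈ (backwardWalk q hq.le n s).support := by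
  induction hmn with
  | refl => exact h
  | step _ ih => exact (mem_support_backwardWalk_succ hq _ _ _).2 (Or.inl ih)

theorem mem_support_backwardWalk_self {q : ℝ≥0} (hq : 1 < q) {b : ℕ} (n : ℕ) (s : FlagState b) :
    s ∈ (backwardWalk q hq.le n s).support :=
  mem_support_backwardWalk_mono hq n.zero_le (by simp [backwardWalk])

/-- A throw can be undone by the leftward walk. -/
theorem mem_support_backwardWalk_of_throwWalk {q : ℝ≥0} (hq : 1 < q) {b : ℕ} {τ s t : FlagState b}
    {n : ℕ} (hw : ThrowWalk (attachDash τ) (n + 1) s) (h0 : letter s 0 ≠ ⊤)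
    (ht : t ∈ (backwardWalk q hq.le n s).support) :
    t ∈ (backwardWalk q hq.le (width τ) (attachDash τ)).support := by
  generalize hm : n + 1 = m at hw
  induction hw generalizing n with
  | skip m s _ ih =>
    subst hm
    exact ih h0 (mem_support_backwardWalk_mono hq n.le_succ ht) rfl
  | bump m s hm' hlt _ ih =>
    subst hm
    refine ih (by rwa [letter_swapLetters_left]) ?_ rfl
    -- After the bump the larger number is in the hand and the smaller one in the word, exactly
    -- where the leftward walk may undo the exchange.
    rw [mem_support_backwardWalk_succ hq, letter_swapLetters_left, letter_swapLetters_right,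
      swapLetters_swapLetters]
    exact Or.inr ⟨hlt, ht⟩
  | place m s hm' hs =>
    subst hm
    obtain ⟨k, hk⟩ := WithTop.ne_top_iff_exists.1 h0
    -- The placed label shows that position `n + 1` is within the width of `τ`, so the leftward walk
    -- visits it.
    have hk' : attachDash τ k = n + 1 := by
      rw [← letter_eq_coe_iff, ← hs, letter_swapLetters_right, hk]
    have hw := lt_width τ k
    rw [attachDash_apply] at hk'
    refine mem_support_backwardWalk_mono hq (m := n + 1) (by omega) ?_
    rw [← hs, mem_support_backwardWalk_succ hq, letter_swapLetters_left, letter_swapLetters_right,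
      swapLetters_swapLetters, hm']
    exact Or.inr ⟨lt_top_iff_ne_top.2 h0, ht⟩

/-- Each exchange made while walking left becomes a bump put in front of the throw already built;
heads becomes a skip. -/
theorem throwWalk_of_mem_support {q : ℝ≥0} (hq : 1 < q) {b : ℕ} {u s t : FlagState b} {n : ℕ}
    (ht : t ∈ (backwardWalk q hq.le n s).support) (hw : ThrowWalk u (n + 1) s)
    (h0 : letter s 0 ≠ ⊤) : letter t 0 ≠ ⊤ ∧ ThrowWalk u 1 t := by
  induction n generalizing s with
  | zero =>
    obtain rfl : t = s := by simpa [backwardWalk] using ht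
    exact ⟨h0, hw⟩
  | succ n ih =>
    rcases (mem_support_backwardWalk_succ hq _ _ _).1 ht with h | ⟨hlt, h⟩
    · exact ih h (hw.skip _ _) h0
    · refine ih h (.bump _ _ ?_ ?_ ?_) ?_
      · rwa [letter_swapLetters_right]
      · rwa [letter_swapLetters_left, letter_swapLetters_right]
      · rwa [swapLetters_swapLetters]
      · rw [letter_swapLetters_left]
        exact hlt.ne_top

/-- The first tails exchanges the held dash with a label, which reversed is the final placement of a
throw; without tails nothing changes. -/
theorem eq_or_throwWalk_of_mem_support {q : ℝ≥0} (hq : 1 < q) {b : ℕ} {u t : FlagState b} {n : ℕ}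
    (ht : t ∈ (backwardWalk q hq.le n u).support) (h0 : letter u 0 = ⊤) :
    t = u ∨ (letter t 0 ≠ ⊤ ∧ ThrowWalk u 1 t) := by
  induction n with
  | zero => exact Or.inl (by simpa [backwardWalk] using ht)
  | succ n ih =>
    rcases (mem_support_backwardWalk_succ hq _ _ _).1 ht with h | ⟨hlt, h⟩
    · exact ih h
    · refine Or.inr (throwWalk_of_mem_support hq h (.place _ _ ?_ (swapLetters_swapLetters _ _ _)) ?_)
      · rwa [letter_swapLetters_right]
      · rw [letter_swapLetters_left]
        exact hlt.ne_top

/-- The states which the backward process can reach from `τ` are those with an edge to `τ`. -/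
theorem mem_support_backwardBumping_iff {q : ℝ≥0} (hq : 1 < q) {b : ℕ} (τ t : FlagState b) :
    t ∈ (backwardBumping q hq.le τ).support ↔ FlagEdge t τ := by
  constructor
  · intro h
    rcases eq_or_throwWalk_of_mem_support hq h (letter_attachDash_zero τ) with rfl | h
    · exact Or.inl ⟨letter_attachDash_zero τ, rfl⟩
    · exact Or.inr h
  · rintro (⟨_, rfl⟩ | ⟨h0, hw⟩)
    · exact mem_support_backwardWalk_self hq _ _
    · exact mem_support_backwardWalk_of_throwWalk hq hw h0 (mem_support_backwardWalk_self hq 0 t)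

theorem randomColumnLaw_eq_backwardBumping {F : Type*} [Field F] [Fintype F] {b : ℕ}
    {τ : FlagState b} {M : FullRankMatrix F b} (hM : M.1 = permMatrix F τ) :
    randomColumnLaw M = backwardBumping (Fintype.card F) (one_le_card F) τ := by
  classical
  rw [backwardBumping, ← map_markedWalk_uniformOfFintype, randomColumnLaw]
  congr 1
  funext c
  exact flagInvariant_prependColumn hM c (markedWalk_attachDash_apply τ _)

end FlagJuggling

theorem mainTheorem8 {F : Type*} [Field F] [Fintype F] {b : ℕ}
    (τ : FlagJuggling.FlagState b) (M : FlagJuggling.FullRankMatrix F b)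
    (hM : FlagJuggling.IsPartialPermutation M.1) (hτ : FlagJuggling.flagInvariant M = τ) :
    (∀ τ' : FlagJuggling.FlagState b,
      FlagJuggling.randomColumnLaw M τ' =
        FlagJuggling.backwardBumping (Fintype.card F) (FlagJuggling.one_le_card F) τ τ') ∧
    (∀ τ' : FlagJuggling.FlagState b,
      τ' ∈ (FlagJuggling.randomColumnLaw M).support ↔ FlagJuggling.FlagEdge τ' τ) := by
  have hlaw := FlagJuggling.randomColumnLaw_eq_backwardBumping (FlagJuggling.eq_permMatrix hM hτ)
  have hq : (1 : NNReal) < (Fintype.card F : NNReal) := by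
    exact_mod_cast Fintype.one_lt_card
  rw [hlaw]
  exact ⟨fun _ => rfl, FlagJuggling.mem_support_backwardBumping_iff hq τ⟩
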